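/- Let $G$ be a finite simple undirected graph on $n$ nodes, let $A\in\{0,1\}^{n\times n}$ be its adjacency matrix, $I$ the $n\times n$ identity matrix, $J$ the $n\times n$ matrix with zeros on the diagonal and ones elsewhere, and $\mathbf 1$ the all-ones column vector. Write $\odot$ for the entrywise product, $\mathrm{diag}(v)$ for the diagonal matrix with diagonal $v$, and $(A^2>0)$ for the $0/1$ matrix whose $(i,j)$ entry is $1$ exactly when $(A^2)_{i,j}>0$. Put $$X_2 = A^2\odot J,$$ $$X_3 = A^3\odot J - A(A^2\odot I) - (A^2\odot I)A + A,$$ $$\begin{aligned}X_4 ={}& A^4\odot J - (A(A^2\odot I-2I)A)\odot J - (A^2\odot I)X_2 - X_2(A^2\odot I)\\ &- A(A^3\odot I) - (A^3\odot I)A + 3A^2\odot A,\end{aligned}$$ $$\begin{aligned} X_5 ={}& A^5\odot J - A(A^2\odot I)(A^2\odot I-I) - (A^2\odot I)A(A^2\odot I) - (A^2\odot I-I)(A^2\odot I)A\\ &- (A(A^2\odot I-I)X_2)\odot J - (X_2(A^2\odot I-I)A)\odot J - (A^2\odot I)X_3 - X_3(A^2\odot I-I)\\ &- (A^3\odot I)X_2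 - X_2(A^3\odot I) - (A(A^3\odot I)A)\odot J - A\odot A^2\\ &+ 3\bigl(A(A\odot A^2)+(A\odot A^2)A\bigr)\odot J - A\,\mathrm{diag}((A\odot X_3)\mathbf 1) - \mathrm{diag}((A\odot X_3)\mathbf 1)A\\ &+ 3A\odot X_3 + 3A\odot A^2\odot(A^2-(A^2>0)). \end{aligned}$$ Then for every $2\le l\le 5$ the vector $X_l\mathbf 1$ counts the $l$-paths starting from each node: for every node $i$, $(X_l\mathbf 1)_i$ is the number of paths in $G$ (walks with no repeated vertex) that start at $i$ and have exactly $l$ edges. Moreover $X_l\mathbf 1$ is a vector word in $A$ of the matrix language MATLANG: for each $l$ there is a single expression, independent of $G$ and $n$, built from $A$ by the operations of matrix product, transpose, all-ones column vector, diagonal matrix of a column vector, entrywise product, addition, multiplication by a scalar expression and entrywise application of a function $\mathbb R\to\mathbb R$, whose value at the adjacency matrix of every such $G$ is $X_l\mathbf 1$. -/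

import Mathlib

open scoped Matrix

universe u

noncomputable section

namespace PathCount

/-! ### The explicit path matrices -/

section Matrices

variable {V : Type u} [Fintype V] [DecidableEq V]

/-- The matrix `J`: ones everywhere except for zeros on the diagonal. -/
def offDiag (V : Type u) [DecidableEq V] : Matrix V V ℝ :=
  Matrix.of fun i j => if i = j then 0 else 1

/-- The entrywise indicator matrix `(M > 0)`. -/
def posInd (M : Matrix V V ℝ) : Matrix V V ℝ :=
  Matrix.of fun i j => if 0 < M i j then 1 else 0

/-- `X₂ = A² ⊙ J`. -/
def X2 (A : Matrix V V ℝ) : Matrix V V ℝ :=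
  (A ^ 2) ⊙ offDiag V

/-- `X₃`. -/
def X3 (A : Matrix V V ℝ) : Matrix V V ℝ :=
  (A ^ 3) ⊙ offDiag V - A * ((A ^ 2) ⊙ 1) - ((A ^ 2) ⊙ 1) * A + A

/-- `X₄`. -/
def X4 (A : Matrix V V ℝ) : Matrix V V ℝ :=
  (A ^ 4) ⊙ offDiag V - (A * ((A ^ 2) ⊙ 1 - (2 : ℝ) • (1 : Matrix V V ℝ)) * A) ⊙ offDiag V
    - ((A ^ 2) ⊙ 1) * X2 A - X2 A * ((A ^ 2) ⊙ 1)
    - A * ((A ^ 3) ⊙ 1) - ((A ^ 3) ⊙ 1) * A + (3 : ℝ) • ((A ^ 2) ⊙ A)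

/-- `X₅`. -/
def X5 (A : Matrix V V ℝ) : Matrix V V ℝ :=
  (A ^ 5) ⊙ offDiag V - A * ((A ^ 2) ⊙ 1) * ((A ^ 2) ⊙ 1 - 1)
    - ((A ^ 2) ⊙ 1) * A * ((A ^ 2) ⊙ 1) - ((A ^ 2) ⊙ 1 - 1) * ((A ^ 2) ⊙ 1) * A
    - (A * ((A ^ 2) ⊙ 1 - 1) * X2 A) ⊙ offDiag V
    - (X2 A * ((A ^ 2) ⊙ 1 - 1) * A) ⊙ offDiag V
    - ((A ^ 2) ⊙ 1) * X3 A - X3 A * ((A ^ 2) ⊙ 1 - 1)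
    - ((A ^ 3) ⊙ 1) * X2 A - X2 A * ((A ^ 3) ⊙ 1)
    - (A * ((A ^ 3) ⊙ 1) * A) ⊙ offDiag V - A ⊙ (A ^ 2)
    + (3 : ℝ) • ((A * (A ⊙ (A ^ 2)) + (A ⊙ (A ^ 2)) * A) ⊙ offDiag V)
    - A * Matrix.diagonal ((A ⊙ X3 A) *ᵥ 1) - Matrix.diagonal ((A ⊙ X3 A) *ᵥ 1) * A
    + (3 : ℝ) • (A ⊙ X3 A)
    + (3 : ℝ) • (A ⊙ ((A ^ 2) ⊙ (A ^ 2 - posInd (A ^ 2))))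

/-- The matrix `X_l` for `2 ≤ l ≤ 5` (only these values are meaningful). -/
def pathMatrix (l : ℕ) (A : Matrix V V ℝ) : Matrix V V ℝ :=
  match l with
  | 2 => X2 A
  | 3 => X3 A
  | 4 => X4 A
  | 5 => X5 A
  | _ => 0

end Matrices

/-! ### Words of the matrix language -/

/-- A dimension of a word evaluated at an `n × n` matrix: either `1` or `n`. -/
inductive Dim where
  | unit
  | node

/-- The index set of a dimension. -/
def Dim.Idx (V : Type u) : Dim → Type u
  | .unit => PUnit
  | .node => V

instance Dim.instFintypeIdx (V : Type u) [Fintype V] : (d : Dim) → Fintype (d.Idx V)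
  | .unit => inferInstanceAs (Fintype PUnit)
  | .node => inferInstanceAs (Fintype V)

instance Dim.instDecidableEqIdx (V : Type u) [DecidableEq V] : (d : Dim) → DecidableEq (d.Idx V)
  | .unit => inferInstanceAs (DecidableEq PUnit)
  | .node => inferInstanceAs (DecidableEq V)

/-- Well-typed words of the matrix language with the operations matrix product, transpose,
all-ones column vector, diagonal matrix of a column vector, entrywise product, and also
addition, multiplication by a scalar word and entrywise application of a function, over one
variable standing for a square matrix. Words of shape `(node, node)` are square matrices, of
shape `(node, unit)` column vectors, `(unit, node)` row vectors and `(unit, unit)` scalars. -/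
inductive Word : Dim → Dim → Type where
  | var : Word .node .node
  | mul {a b c : Dim} : Word a b → Word b c → Word a c
  | transpose {a b : Dim} : Word a b → Word b a
  | ones {a b : Dim} : Word a b → Word a .unit
  | diag {a : Dim} : Word a .unit → Word a a
  | hadamard {a b : Dim} : Word a b → Word a b → Word a b
  | add {a b : Dim} : Word a b → Word a b → Word a b
  | scale {a b : Dim} : Word .unit .unit → Word a b → Word a b
  | map {a b : Dim} : (ℝ → ℝ) → Word a b → Word a b

/-- The value of a word at a square matrix `A`. -/
def Word.eval {V : Type u} [Fintype V] [DecidableEq V] (A : Matrix V V ℝ) :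
    {a b : Dim} → Word a b → Matrix (a.Idx V) (b.Idx V) ℝ
  | _, _, .var => A
  | _, _, .mul w w' => w.eval A * w'.eval A
  | _, _, .transpose w => (w.eval A)ᵀ
  | _, _, .ones _ => Matrix.of fun _ _ => 1
  | _, _, .diag w => Matrix.diagonal fun i => w.eval A i PUnit.unit
  | _, _, .hadamard w w' => w.eval A ⊙ w'.eval A
  | _, _, .add w w' => w.eval A + w'.eval A
  | _, _, .scale s w => (s.eval A PUnit.unit PUnit.unit) • w.eval A
  | _, _, .map f w => (w.eval A).map f

/-- The entries of the column vector computed by a vector word at the matrix `A`. -/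
def Word.evalVec {V : Type u} [Fintype V] [DecidableEq V] (A : Matrix V V ℝ)
    (w : Word .node .unit) : V → ℝ :=
  fun i => w.eval A i PUnit.unit

/-! ### Counting paths -/

/-- The number of `l`-paths starting from the node `i`: paths with exactly `l` edges (no vertex
is repeated), with first vertex `i` and any last vertex. -/
def numPathsFrom {V : Type u} (G : SimpleGraph V) (l : ℕ) (i : V) : ℕ :=
  Set.ncard {p : Σ j : V, G.Walk i j | p.2.IsPath ∧ p.2.length = l}

end PathCount

end

/-! Deleting the first vertex of a path leaves a shorter path that avoids it. The count `pathSum`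
therefore carries a set `S` of forbidden vertices, enlarged by each vertex passed; over all
endpoints it totals `numPathsFrom` (`numPathsFrom_eq_sum`).

Each step of the recursion is evaluated by inclusion-exclusion (`IsAdj.pathSum_succ`): sum a closed
form for the continuations over all `k`, then subtract its values at the inadmissible `k`, namely
those in `S` and the endpoint. Sums over all `k` turn into powers of `A`, and the rest simplifies by
symmetry, zero diagonal and `A i j * A i j = A i j`. Length 5 with nothing forbidden needs length 4
with one forbidden vertex, which needs length 3 with two; closed forms for lengths 1 to 3 hold for
any `S` avoiding the two distinct endpoints.

Off the diagonal, the entries of `X_l` expand to these closed forms; on it, both sides vanish. So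
the identity holds entry by entry, before summing rows. Expressibility is separate: each defining
formula translates directly into a word. -/

/-! ### Recursive path counts with forbidden vertices -/

namespace PathCount

variable {V : Type u} [Fintype V] [DecidableEq V]

/-- The number of paths with `l` edges from `i` to `j` avoiding the vertices of `S`, weighted by
the entries of `A`. -/
def pathSum (A : Matrix V V ℝ) : ℕ → Finset V → V → V → ℝ
  | 0, S, i, j => if i = j ∧ i ∉ S then 1 else 0
  | l + 1, S, i, j => if i ∈ S then 0 else ∑ k, A i k * pathSum A l (insert i S) k j

/-- Prepending a fixed edge to a walk. -/
def consEmb {V : Type u} {G : SimpleGraph V} {i k : V} (h : G.Adj i k) (j : V) :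
    G.Walk k j ↪ G.Walk i j where
  toFun p := .cons h p
  inj' p q hpq := by
    replace hpq : SimpleGraph.Walk.cons h p = .cons h q := hpq
    simpa using hpq

theorem consEmb_apply {V : Type u} {G : SimpleGraph V} {i k j : V} (h : G.Adj i k)
    (p : G.Walk k j) : consEmb h j p = .cons h p := rfl

theorem card_filter_finsetWalkLength (G : SimpleGraph V) [DecidableRel G.Adj] (l : ℕ)
    (S : Finset V) (i j : V) :
    (((G.finsetWalkLength l i j).filter
      fun p => p.IsPath ∧ ∀ s ∈ S, s ∉ p.support).card : ℝ) = pathSum (G.adjMatrix ℝ) l S i j := by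
  classical
  induction l generalizing S i with
  | zero =>
    unfold pathSum SimpleGraph.finsetWalkLength
    by_cases h : i = j
    · subst h
      by_cases hS : i ∈ S
      · simp [hS, Finset.filter_singleton]
      · have : ∀ s ∈ S, ¬ s = i := fun s hs h => hS (h ▸ hs)
        simp [hS, Finset.filter_singleton]
    · simp [h]
  | succ l ih =>
    unfold pathSum
    split_ifs with hS
    · rw [Nat.cast_eq_zero, Finset.card_eq_zero, Finset.filter_eq_empty_iff]
      rintro p - ⟨-, h⟩
      exact h i hS p.start_mem_support
    -- Partition by second vertex. Indexing by the subtype of neighbours supplies the adjacency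
    -- proof that prepending the edge requires.
    · have h : ((G.finsetWalkLength (l + 1) i j).filter
          fun p => p.IsPath ∧ ∀ s ∈ S, s ∉ p.support) =
          Finset.univ.biUnion fun w : {k // k ∈ G.neighborFinset i} =>
            ((G.finsetWalkLength l w.1 j).filter
              fun p => p.IsPath ∧ ∀ s ∈ insert i S, s ∉ p.support).map
                (consEmb ((G.mem_neighborFinset i w.1).1 w.2) j) := by
        ext p
        simp only [Finset.mem_filter, SimpleGraph.mem_finsetWalkLength_iff, Finset.mem_biUnion,
          Finset.mem_univ, true_and, Finset.mem_map, consEmb_apply]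
        constructor
        · rintro ⟨hl, hp, hs⟩
          cases p with
          | nil => simp at hl
          | cons hadj q =>
            refine ⟨⟨_, (G.mem_neighborFinset i _).2 hadj⟩, q, ⟨?_, ?_, ?_⟩, rfl⟩
            · simpa using hl
            · exact hp.of_cons
            · rw [SimpleGraph.Walk.cons_isPath_iff] at hp
              intro s hsS
              rcases Finset.mem_insert.1 hsS with rfl | hsS
              · exact hp.2
              · have := hs s hsS
                simp only [SimpleGraph.Walk.support_cons, List.mem_cons, not_or] at this
                exact this.2
        · rintro ⟨w, q, ⟨hl, hp, hs⟩, rfl⟩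
          refine ⟨by simp [hl], ?_, ?_⟩
          · rw [SimpleGraph.Walk.cons_isPath_iff]
            exact ⟨hp, hs i (Finset.mem_insert_self i S)⟩
          · intro s hsS
            simp only [SimpleGraph.Walk.support_cons, List.mem_cons, not_or]
            exact ⟨fun h => hS (h ▸ hsS), hs s (Finset.mem_insert_of_mem hsS)⟩
      rw [h, Finset.card_biUnion]
      · simp only [Finset.card_map, Nat.cast_sum, ih]
        rw [Finset.sum_coe_sort (G.neighborFinset i)
          (fun k => pathSum (G.adjMatrix ℝ) l (insert i S) k j)]
        rw [SimpleGraph.neighborFinset_eq_filter, Finset.sum_filter]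
        simp [SimpleGraph.adjMatrix_apply]
      · intro x _ y _ hxy
        rw [Function.onFun, Finset.disjoint_left]
        intro p hp hp'
        simp only [Finset.mem_map, consEmb_apply] at hp hp'
        obtain ⟨q, -, rfl⟩ := hp
        obtain ⟨q', -, h'⟩ := hp'
        rw [SimpleGraph.Walk.cons.injEq] at h'
        exact hxy (Subtype.ext h'.1.symm)

theorem numPathsFrom_eq_sum (G : SimpleGraph V) [DecidableRel G.Adj] (l : ℕ) (i : V) :
    (numPathsFrom G l i : ℝ) = ∑ j, pathSum (G.adjMatrix ℝ) l ∅ i j := by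
  classical
  have h : {p : Σ j : V, G.Walk i j | p.2.IsPath ∧ p.2.length = l} =
      ((Finset.univ.sigma fun j => (G.finsetWalkLength l i j).filter
        fun p => p.IsPath ∧ ∀ s ∈ (∅ : Finset V), s ∉ p.support : Finset (Σ j : V, G.Walk i j)) :
          Set (Σ j : V, G.Walk i j)) := by
    ext p
    simp [SimpleGraph.mem_finsetWalkLength_iff, and_comm]
  rw [numPathsFrom, h, Set.ncard_coe_finset, Finset.card_sigma, Nat.cast_sum]
  exact Finset.sum_congr rfl fun j _ => card_filter_finsetWalkLength G l ∅ i j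

end PathCount

/-! ### Closed forms up to length 4 -/

namespace PathCount

variable {V : Type u} [Fintype V] [DecidableEq V]

theorem pathSum_of_mem (A : Matrix V V ℝ) (l : ℕ) {S : Finset V} {i : V} (j : V) (h : i ∈ S) :
    pathSum A l S i j = 0 := by
  cases l <;> simp [pathSum, h]

theorem pathSum_of_mem_right (A : Matrix V V ℝ) (l : ℕ) {S : Finset V} (i : V) {j : V}
    (h : j ∈ S) : pathSum A l S i j = 0 := by
  induction l generalizing S i with
  | zero => simpa [pathSum] using fun h' => h' ▸ h
  | succ l ih =>
    rw [pathSum]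
    split_ifs
    · rfl
    · exact Finset.sum_eq_zero fun k _ => by rw [ih k (Finset.mem_insert_of_mem h), mul_zero]

/-- After one step the start is forbidden, so no path can end there. -/
theorem pathSum_succ_self (A : Matrix V V ℝ) (l : ℕ) (S : Finset V) (i : V) :
    pathSum A (l + 1) S i i = 0 := by
  rw [pathSum]
  split_ifs
  · rfl
  · exact Finset.sum_eq_zero fun k _ => by
      rw [pathSum_of_mem_right A l k (Finset.mem_insert_self i S), mul_zero]

/-- The properties of adjacency matrices that the path counts use. -/
structure IsAdj (A : Matrix V V ℝ) : Prop where
  symm : ∀ i j, A j i = A i j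
  diag : ∀ i, A i i = 0
  zero_or_one : ∀ i j, A i j = 0 ∨ A i j = 1

omit [Fintype V] [DecidableEq V] in
theorem isAdj_adjMatrix (G : SimpleGraph V) [DecidableRel G.Adj] : IsAdj (G.adjMatrix ℝ) where
  symm i j := by simp [SimpleGraph.adjMatrix_apply, G.adj_comm]
  diag i := by simp
  zero_or_one i j := by
    by_cases h : G.Adj i j <;> simp [SimpleGraph.adjMatrix_apply, h]

theorem sum_mul_pow_apply (A : Matrix V V ℝ) (n : ℕ) (i j : V) :
    ∑ k, A i k * (A ^ n) k j = (A ^ (n + 1)) i j := by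
  rw [pow_succ', Matrix.mul_apply]

theorem sum_mul_apply (A : Matrix V V ℝ) (i j : V) :
    ∑ k, A i k * A k j = (A ^ 2) i j := by
  rw [pow_two, Matrix.mul_apply]

namespace IsAdj

variable {A : Matrix V V ℝ} (hA : IsAdj A)
include hA

omit [Fintype V] [DecidableEq V] in
theorem mul_self (i j : V) : A i j * A i j = A i j := by
  rcases hA.zero_or_one i j with h | h <;> simp [h]

omit [Fintype V] [DecidableEq V] in
theorem transpose_eq : Aᵀ = A := Matrix.ext fun i j => hA.symm i j

theorem pow_symm (n : ℕ) (i j : V) : (A ^ n) j i = (A ^ n) i j := by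
  conv_rhs => rw [← hA.transpose_eq, ← Matrix.transpose_pow, Matrix.transpose_apply]

theorem sum_row (i : V) : ∑ k, A i k = (A ^ 2) i i := by
  rw [← sum_mul_apply]
  exact Finset.sum_congr rfl fun k _ => by rw [hA.symm i k, hA.mul_self]

theorem sq_nonneg_apply (i j : V) : 0 ≤ (A ^ 2) i j := by
  rw [← sum_mul_apply]
  refine Finset.sum_nonneg fun k _ => mul_nonneg ?_ ?_
  · rcases hA.zero_or_one i k with h | h <;> simp [h]
  · rcases hA.zero_or_one k j with h | h <;> simp [h]

/-- If `F k` is the number of continuations through `k`, wherever `k` is admissible, then the sum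
over all `k` has to be corrected at the vertices that are not. -/
theorem pathSum_succ {l : ℕ} {S : Finset V} {i j : V} (hi : i ∉ S) (hj : j ∉ S)
    (F : V → ℝ)
    (hF : ∀ k, k ∉ S → k ≠ i → k ≠ j → A i k = 1 → pathSum A (l + 1) (insert i S) k j = F k) :
    pathSum A (l + 2) S i j =
      ∑ k, A i k * F k - ∑ s ∈ S, A i s * F s - A i j * F j := by
  -- At `k = i` the weight `A i i` is already zero. At `k = j` the true count vanishes because the
  -- remaining length `l + 1` is positive, but `F j` need not. As `j ∉ S`, nothing is subtracted
  -- twice.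
  have h : ∀ k, A i k * pathSum A (l + 1) (insert i S) k j =
      A i k * F k - (if k ∈ S then A i k * F k else 0) - (if k = j then A i k * F k else 0) := by
    intro k
    rcases hA.zero_or_one i k with h0 | h1
    · simp [h0]
    · have hki : k ≠ i := by
        rintro rfl
        rw [hA.diag] at h1
        exact zero_ne_one h1
      by_cases hkj : k = j
      · subst hkj
        simp [pathSum_succ_self, hj]
      · by_cases hkS : k ∈ S
        · simp [pathSum_of_mem A _ j (Finset.mem_insert_of_mem hkS), hkS, hkj]
        · simp [hF k hkS hki hkj h1, hkS, hkj]
  rw [pathSum, if_neg hi, Finset.sum_congr rfl fun k _ => h k]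
  simp only [Finset.sum_sub_distrib, Finset.sum_ite_mem, Finset.univ_inter, Finset.sum_ite_eq',
    Finset.mem_univ, if_true]

omit hA in
theorem pathSum_one {S : Finset V} {i j : V} (hi : i ∉ S) (hj : j ∉ S) (hij : i ≠ j) :
    pathSum A 1 S i j = A i j := by
  simp only [pathSum, if_neg hi]
  rw [Finset.sum_eq_single j]
  · simp [hj, hij.symm]
  · intro k _ hk
    simp [hk]
  · simp

theorem pathSum_two {S : Finset V} {i j : V} (hi : i ∉ S) (hj : j ∉ S) (hij : i ≠ j) :
    pathSum A 2 S i j = (A ^ 2) i j - ∑ s ∈ S, A i s * A s j := by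
  rw [hA.pathSum_succ (l := 0) hi hj (fun k => A k j), sum_mul_apply, hA.diag, mul_zero, sub_zero]
  intro k hk hki hkj _
  exact pathSum_one (by simp [hk, hki]) (by simp [hj, hij.symm]) hkj

theorem pathSum_three {S : Finset V} {i j : V} (hi : i ∉ S) (hj : j ∉ S) (hij : i ≠ j) :
    pathSum A 3 S i j = (A ^ 3) i j - (A ^ 2) i i * A i j - ∑ s ∈ S, (A ^ 2) i s * A s j
      - ∑ t ∈ S, A i t * ((A ^ 2) t j - A t i * A i j - ∑ s ∈ S, A t s * A s j)
      - A i j * ((A ^ 2) j j - A j i * A i j - ∑ s ∈ S, A j s * A s j) := by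
  rw [hA.pathSum_succ (l := 1) hi hj
    (fun k => (A ^ 2) k j - A k i * A i j - ∑ s ∈ S, A k s * A s j)]
  · congr 2
    simp only [mul_sub, Finset.sum_sub_distrib, Finset.mul_sum, ← mul_assoc]
    rw [Finset.sum_comm]
    simp only [← Finset.sum_mul, sum_mul_apply, sum_mul_pow_apply]
  · intro k hk hki hkj _
    rw [hA.pathSum_two (by simp [hk, hki]) (by simp [hj, hij.symm]) hkj, Finset.sum_insert hi]
    ring

theorem pathSum_four_empty {i j : V} (hij : i ≠ j) :
    pathSum A 4 ∅ i j = (A ^ 4) i j - ∑ k, A i k * (A ^ 2) k k * A k j - (A ^ 3) i i * A i j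
      - (A ^ 2) i i * (A ^ 2) i j + (A ^ 2) i j - (A ^ 2) i j * ((A ^ 2) j j - 1 - A i j)
      - A i j * ((A ^ 3) j j - 2 * (A ^ 2) i j) := by
  rw [hA.pathSum_succ (l := 2) (by simp) (by simp)
    -- This is the length 3 formula with `S = {i}`, simplified by `A i k = 1`; the constant 1 arises
    -- from `A k j ^ 3 = A k j`.
    (fun k => (A ^ 3) k j - (A ^ 2) k k * A k j - (A ^ 2) k i * A i j - ((A ^ 2) i j - A k j)
      - A k j * ((A ^ 2) j j - 1 - A i j))]
  · have h : ∀ k, A i k * ((A ^ 3) k j - (A ^ 2) k k * A k j - (A ^ 2) k i * A i j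
        - ((A ^ 2) i j - A k j) - A k j * ((A ^ 2) j j - 1 - A i j)) =
        A i k * (A ^ 3) k j - A i k * (A ^ 2) k k * A k j - A i k * (A ^ 2) k i * A i j
        - A i k * (A ^ 2) i j + A i k * A k j - A i k * A k j * ((A ^ 2) j j - 1 - A i j) := by
      intro k; ring
    rw [Finset.sum_congr rfl fun k _ => h k]
    simp only [Finset.sum_sub_distrib, Finset.sum_add_distrib, ← Finset.sum_mul, sum_mul_apply,
      sum_mul_pow_apply, hA.sum_row, hA.diag, hA.pow_symm 2 i j, Finset.sum_empty]
    -- The square of `A i j` comes from the correction at `k = j`.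
    linear_combination (A ^ 2) i j * hA.mul_self i j
  · intro k _ hki hkj hik
    rw [hA.pathSum_three (by simpa using hki) (by simpa using hij.symm) hkj]
    simp only [insert_empty_eq, Finset.sum_singleton, hA.diag, hA.symm i k, hik, hA.symm i j,
      hA.symm k j]
    linear_combination (A k j) * hA.mul_self k j + hA.mul_self k j + A k j * hA.mul_self i j

end IsAdj

end PathCount

/-! ### Closed form for length 5 -/

namespace PathCount
namespace IsAdj

variable {V : Type u} [Fintype V] [DecidableEq V] {A : Matrix V V ℝ} (hA : IsAdj A)
include hA

/-- The situation after two edges `i, k, x` of a path of length 5. The entry `A i x` stays free,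
since the three vertices may form a triangle. -/
theorem pathSum_three_pair {i k x j : V} (hik : A i k = 1) (hkx : A k x = 1) (hxi : x ≠ i)
    (hki : k ≠ i) (hkj : k ≠ j) (hij : i ≠ j) (hxj : x ≠ j) :
    pathSum A 3 {k, i} x j = (A ^ 3) x j - (A ^ 2) x x * A x j - (A ^ 2) k x * A k j
      - (A ^ 2) i x * A i j - ((A ^ 2) k j - A x j - A i j)
      - A i x * ((A ^ 2) i j - A x j - A k j) - A x j * ((A ^ 2) j j - 1 - A k j - A i j) := by
  have hxk : x ≠ k := by
    rintro rfl
    rw [hA.diag] at hkx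
    exact zero_ne_one hkx
  rw [hA.pathSum_three (by simp [hxi, hxk]) (by simp [hij.symm, hkj.symm]) hxj]
  simp only [Finset.sum_pair hki, hA.diag, hA.symm i k, hA.symm k x, hA.symm i x, hik, hkx,
    hA.symm x j, hA.symm k j, hA.symm i j, hA.pow_symm 2 k x, hA.pow_symm 2 i x]
  linear_combination (A x j) * hA.mul_self x j + hA.mul_self x j + A x j * hA.mul_self i j +
    A x j * hA.mul_self k j + A x j * hA.mul_self i x

/-- The situation after the first edge `i, k` of a path of length 5. -/
theorem pathSum_four_singleton {i k j : V} (hik : A i k = 1) (hki : k ≠ i) (hkj : k ≠ j)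
    (hij : i ≠ j) :
    pathSum A 4 {i} k j = (A ^ 4) k j - ∑ x, A k x * (A ^ 2) x x * A x j - (A ^ 3) k k * A k j
      - (A ^ 3) i k * A i j - (A ^ 2) k k * (A ^ 2) k j + (A ^ 2) k j + (A ^ 2) k k * A i j
      - (A ^ 2) i k * (A ^ 2) i j + ∑ x, A k x * A i x * A x j + (A ^ 2) i k * A k j
      - (A ^ 2) k j * ((A ^ 2) j j - 1 - A k j - A i j)
      - ((A ^ 3) i j - 2 * (A ^ 2) i i * A i j - (A ^ 2) i k * A k j - (A ^ 2) k j + 2 * A i j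
        - A i j * ((A ^ 2) j j - 1 - A k j - A i j))
      - A k j * ((A ^ 3) j j - 2 * (A ^ 2) k j - 2 * A i j * (A ^ 2) i j + 2 * A i j) := by
  rw [hA.pathSum_succ (l := 2) (by simpa using hki) (by simpa using hij.symm)
    (fun x => (A ^ 3) x j - (A ^ 2) x x * A x j - (A ^ 2) k x * A k j
      - (A ^ 2) i x * A i j - ((A ^ 2) k j - A x j - A i j)
      - A i x * ((A ^ 2) i j - A x j - A k j) - A x j * ((A ^ 2) j j - 1 - A k j - A i j))]
  · have h : ∀ x, A k x * ((A ^ 3) x j - (A ^ 2) x x * A x j - (A ^ 2) k x * A k j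
        - (A ^ 2) i x * A i j - ((A ^ 2) k j - A x j - A i j)
        - A i x * ((A ^ 2) i j - A x j - A k j) - A x j * ((A ^ 2) j j - 1 - A k j - A i j)) =
        A k x * (A ^ 3) x j - A k x * (A ^ 2) x x * A x j - A k x * (A ^ 2) x k * A k j
        - A k x * (A ^ 2) x i * A i j - A k x * (A ^ 2) k j + A k x * A x j + A k x * A i j
        - A k x * A x i * (A ^ 2) i j + A k x * A i x * A x j + A k x * A x i * A k j
        - A k x * A x j * ((A ^ 2) j j - 1 - A k j - A i j) := by
      intro x
      rw [hA.symm i x, hA.pow_symm 2 i x, hA.pow_symm 2 k x]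
      ring
    rw [Finset.sum_congr rfl fun x _ => h x]
    simp only [Finset.sum_sub_distrib, Finset.sum_add_distrib, ← Finset.sum_mul, sum_mul_apply,
      sum_mul_pow_apply, hA.sum_row, hA.diag, hA.pow_symm 2 i k, hA.pow_symm 3 i k,
      Finset.sum_singleton, hA.symm i k, hik]
    linear_combination ((A ^ 2) k j - A i j) * hA.mul_self k j
  · intro x hxi hxk hxj hkx
    rw [Finset.mem_singleton] at hxi
    exact hA.pathSum_three_pair hik hkx hxi hki hkj hij hxj

theorem pathSum_five_empty {i j : V} (hij : i ≠ j) :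
    pathSum A 5 ∅ i j = (A ^ 5) i j - ∑ k, (A ^ 2) i k * (A ^ 2) k k * A k j
      - ∑ k, A i k * (A ^ 3) k k * A k j - ∑ k, A i k * (A ^ 2) k k * (A ^ 2) k j
      + 3 * ∑ k, A i k * (A ^ 2) i k * A k j + 3 * ∑ k, A i k * (A ^ 2) k j * A k j
      + (3 - (A ^ 2) i i - (A ^ 2) j j) * (A ^ 3) i j
      - ((A ^ 3) i i + (A ^ 3) j j) * (A ^ 2) i j
      + A i j * (∑ k, A i k * (A ^ 2) k k + ∑ k, A j k * (A ^ 2) k k - (A ^ 4) i i - (A ^ 4) j j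
        + 3 * (A ^ 3) i j - 4 * (A ^ 2) i j + 3 * (A ^ 2) i j ^ 2 - 6 * (A ^ 2) i i
        - 6 * (A ^ 2) j j + (A ^ 2) i i * (A ^ 2) j j + 2 * (A ^ 2) i i ^ 2
        + 2 * (A ^ 2) j j ^ 2 + 4) := by
  rw [hA.pathSum_succ (l := 3) (by simp) (by simp)
    (fun k => (A ^ 4) k j - ∑ x, A k x * (A ^ 2) x x * A x j - (A ^ 3) k k * A k j
      - (A ^ 3) i k * A i j - (A ^ 2) k k * (A ^ 2) k j + (A ^ 2) k j + (A ^ 2) k k * A i j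
      - (A ^ 2) i k * (A ^ 2) i j + ∑ x, A k x * A i x * A x j + (A ^ 2) i k * A k j
      - (A ^ 2) k j * ((A ^ 2) j j - 1 - A k j - A i j)
      - ((A ^ 3) i j - 2 * (A ^ 2) i i * A i j - (A ^ 2) i k * A k j - (A ^ 2) k j + 2 * A i j
        - A i j * ((A ^ 2) j j - 1 - A k j - A i j))
      - A k j * ((A ^ 3) j j - 2 * (A ^ 2) k j - 2 * A i j * (A ^ 2) i j + 2 * A i j))]
  · have h : ∀ k, A i k * ((A ^ 4) k j - ∑ x, A k x * (A ^ 2) x x * A x j - (A ^ 3) k k * A k j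
      - (A ^ 3) i k * A i j - (A ^ 2) k k * (A ^ 2) k j + (A ^ 2) k j + (A ^ 2) k k * A i j
      - (A ^ 2) i k * (A ^ 2) i j + ∑ x, A k x * A i x * A x j + (A ^ 2) i k * A k j
      - (A ^ 2) k j * ((A ^ 2) j j - 1 - A k j - A i j)
      - ((A ^ 3) i j - 2 * (A ^ 2) i i * A i j - (A ^ 2) i k * A k j - (A ^ 2) k j + 2 * A i j
        - A i j * ((A ^ 2) j j - 1 - A k j - A i j))
      - A k j * ((A ^ 3) j j - 2 * (A ^ 2) k j - 2 * A i j * (A ^ 2) i j + 2 * A i j)) =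
      A i k * (A ^ 4) k j - A i k * ∑ x, A k x * (A ^ 2) x x * A x j - A i k * (A ^ 3) k k * A k j
      - A i k * (A ^ 3) k i * A i j - A i k * (A ^ 2) k k * (A ^ 2) k j + A i k * (A ^ 2) k j
      + A i k * (A ^ 2) k k * A i j
      - A i k * (A ^ 2) k i * (A ^ 2) i j + A i k * ∑ x, A k x * A i x * A x j
      + 2 * (A i k * (A ^ 2) i k * A k j)
      - A i k * (A ^ 2) k j * ((A ^ 2) j j - 1 - A i j)
      + 3 * (A i k * (A ^ 2) k j * A k j)
      - A i k * ((A ^ 3) i j - 2 * (A ^ 2) i i * A i j + 2 * A i j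
          - A i j * ((A ^ 2) j j - 1 - A i j))
      + A i k * (A ^ 2) k j - A i k * A k j * A i j
      - A i k * A k j * ((A ^ 3) j j - 2 * A i j * (A ^ 2) i j + 2 * A i j) := by
      intro k
      rw [hA.pow_symm 3 i k, hA.pow_symm 2 i k]
      ring
    -- Exchanging the sums here and in `hE` lets the inner sum over `k` become `(A ^ 2) i x`.
    have hZ : ∑ k, A i k * ∑ x, A k x * A i x * A x j = ∑ k, A i k * (A ^ 2) i k * A k j := by
      simp only [Finset.mul_sum]
      rw [Finset.sum_comm]
      refine Finset.sum_congr rfl fun k _ => ?_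
      simp only [← sum_mul_apply, Finset.sum_mul, Finset.mul_sum]
      exact Finset.sum_congr rfl fun x _ => by ring
    have hE : ∑ k, A i k * ∑ x, A k x * (A ^ 2) x x * A x j =
        ∑ k, (A ^ 2) i k * (A ^ 2) k k * A k j := by
      simp only [Finset.mul_sum]
      rw [Finset.sum_comm]
      refine Finset.sum_congr rfl fun k _ => ?_
      rw [← sum_mul_apply A i k]
      simp only [Finset.sum_mul]
      exact Finset.sum_congr rfl fun x _ => by ring
    -- `hE'` and `hZ'` evaluate the inner sums in the correction at `k = j`, where the edge between
    -- `x` and `j` occurs twice.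
    have hE' : ∑ x, A j x * (A ^ 2) x x * A x j = ∑ x, A j x * (A ^ 2) x x :=
      Finset.sum_congr rfl fun x _ => by
        rw [hA.symm j x]; linear_combination (A ^ 2) x x * hA.mul_self j x
    have hZ' : ∑ x, A j x * A i x * A x j = (A ^ 2) i j := by
      rw [← sum_mul_apply]
      refine Finset.sum_congr rfl fun x _ => ?_
      rw [hA.symm x j]; linear_combination A i x * hA.mul_self x j
    rw [Finset.sum_congr rfl fun k _ => h k]
    simp only [Finset.sum_sub_distrib, Finset.sum_add_distrib, ← Finset.sum_mul,
      ← Finset.mul_sum, sum_mul_apply, hZ, hE, hE', hZ',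
      sum_mul_pow_apply, hA.sum_row, hA.diag, Finset.sum_empty]
    simp only [Nat.reduceAdd]
    linear_combination ((A ^ 3) i j - 3 * (A ^ 2) j j - 3 * (A ^ 2) i i + 4 + A i j) *
      hA.mul_self i j
  · intro k _ hki hkj hik
    exact hA.pathSum_four_singleton hik hki hkj hij

end IsAdj
end PathCount

/-! ### The path matrices as words -/

namespace PathCount

namespace Word

/-- The identity matrix as a word. -/
def one : Word .node .node := diag (ones var)

/-- The word for the matrix `J`. -/
def offDiag : Word .node .node := map (fun x => 1 - x) one

/-- The difference of two words. -/
def sub {a b : Dim} (w w' : Word a b) : Word a b := add w (map (fun x => -x) w')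

/-- The product of a word by a real constant. -/
def smul {a b : Dim} (c : ℝ) (w : Word a b) : Word a b := map (fun x => c * x) w

/-- The word for the diagonal of a square matrix. -/
def diagPart (w : Word .node .node) : Word .node .node := hadamard w one

/-- The word for the part of a square matrix off the diagonal. -/
def offPart (w : Word .node .node) : Word .node .node := hadamard w offDiag

/-- The word for `A²`. -/
def sq : Word .node .node := mul var var

/-- The word for `A³`. -/
def cube : Word .node .node := mul sq var

/-- The word for `X₂`. -/
def x2 : Word .node .node := offPart sq

/-- The word for `X₃`. -/
def x3 : Word .node .node :=
  add (sub (sub (offPart cube) (mul var (diagPart sq))) (mul (diagPart sq) var)) var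

/-- The word for `X₄`. -/
def x4 : Word .node .node :=
  add (sub (sub (sub (sub (sub (offPart (mul cube var))
    (offPart (mul (mul var (sub (diagPart sq) (smul 2 one))) var)))
    (mul (diagPart sq) x2)) (mul x2 (diagPart sq)))
    (mul var (diagPart cube))) (mul (diagPart cube) var)) (smul 3 (hadamard sq var))

/-- The word for `diag((A ⊙ X₃) 1)`. -/
def rowDiag : Word .node .node := diag (mul (hadamard var x3) (ones var))

/-- The word for the indicator `(A² > 0)`. -/
noncomputable def sqPos : Word .node .node := map (fun x => if 0 < x then 1 else 0) sq

/-- The word for `X₅`. -/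
noncomputable def x5 : Word .node .node :=
  let d := diagPart sq
  let t := diagPart cube
  let d' := sub d one
  let w₁ := sub (offPart (mul (mul cube var) var)) (mul (mul var d) d')
  let w₂ := sub (sub w₁ (mul (mul d var) d)) (mul (mul d' d) var)
  let w₃ := sub w₂ (offPart (mul (mul var d') x2))
  let w₄ := sub w₃ (offPart (mul (mul x2 d') var))
  let w₅ := sub (sub w₄ (mul d x3)) (mul x3 d')
  let w₆ := sub (sub w₅ (mul t x2)) (mul x2 t)
  let w₇ := sub (sub w₆ (offPart (mul (mul var t) var))) (hadamard var sq)
  let w₈ := add w₇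
    (smul 3 (offPart (add (mul var (hadamard var sq)) (mul (hadamard var sq) var))))
  let w₉ := sub (sub w₈ (mul var rowDiag)) (mul rowDiag var)
  add (add w₉ (smul 3 (hadamard var x3))) (smul 3 (hadamard var (hadamard sq (sub sq sqPos))))

variable {V : Type u} [Fintype V] [DecidableEq V] (A : Matrix V V ℝ)

/-- The value of a square matrix word, as a matrix indexed by the nodes. -/
def matEval (w : Word .node .node) : Matrix V V ℝ := w.eval A

theorem matEval_var : var.matEval A = A := rfl

theorem matEval_mul (w w' : Word .node .node) :
    (mul w w').matEval A = w.matEval A * w'.matEval A := rfl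

theorem matEval_add (w w' : Word .node .node) :
    (add w w').matEval A = w.matEval A + w'.matEval A := rfl

theorem matEval_hadamard (w w' : Word .node .node) :
    (hadamard w w').matEval A = w.matEval A ⊙ w'.matEval A := rfl

theorem matEval_map (f : ℝ → ℝ) (w : Word .node .node) :
    (map f w).matEval A = (w.matEval A).map f := rfl

theorem matEval_one : one.matEval A = 1 := Matrix.diagonal_one

theorem matEval_offDiag : offDiag.matEval A = PathCount.offDiag V := by
  rw [offDiag, matEval_map, matEval_one]
  ext i j
  by_cases h : i = j <;> simp [PathCount.offDiag, h]

theorem matEval_sub (w w' : Word .node .node) :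
    (sub w w').matEval A = w.matEval A - w'.matEval A := by
  rw [sub, matEval_add, matEval_map]
  ext i j
  simp [sub_eq_add_neg]

theorem matEval_smul (c : ℝ) (w : Word .node .node) :
    (smul c w).matEval A = c • w.matEval A := rfl

theorem matEval_diagPart (w : Word .node .node) :
    (diagPart w).matEval A = w.matEval A ⊙ 1 := by
  rw [diagPart, matEval_hadamard, matEval_one]

theorem matEval_offPart (w : Word .node .node) :
    (offPart w).matEval A = w.matEval A ⊙ PathCount.offDiag V := by
  rw [offPart, matEval_hadamard, matEval_offDiag]

theorem matEval_sq : sq.matEval A = A ^ 2 := (pow_two A).symm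

theorem matEval_cube : cube.matEval A = A ^ 3 := by
  rw [cube, matEval_mul, matEval_sq, matEval_var, ← pow_succ]

theorem matEval_sqPos : sqPos.matEval A = posInd (A ^ 2) := by
  rw [sqPos, matEval_map, matEval_sq]; rfl

theorem matEval_x2 : x2.matEval A = X2 A := by
  rw [x2, matEval_offPart, matEval_sq, X2]

theorem matEval_x3 : x3.matEval A = X3 A := by
  simp only [x3, X3, matEval_offPart, matEval_sq, matEval_add, matEval_sub, matEval_mul,
    matEval_var, matEval_cube, matEval_diagPart]

theorem matEval_x4 : x4.matEval A = X4 A := by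
  simp only [x4, X4, matEval_offPart, matEval_sq, matEval_add, matEval_sub, matEval_mul,
    matEval_var, matEval_cube, matEval_diagPart, matEval_smul, matEval_one, matEval_hadamard,
    matEval_x2, ← pow_succ]

theorem matEval_rowDiag : rowDiag.matEval A = Matrix.diagonal ((A ⊙ X3 A) *ᵥ 1) := by
  rw [← matEval_x3]; rfl

theorem matEval_x5 : x5.matEval A = X5 A := by
  simp only [x5, X5, matEval_offPart, matEval_sq, matEval_add, matEval_sub, matEval_mul,
    matEval_var, matEval_cube, matEval_diagPart, matEval_smul, matEval_one, matEval_hadamard,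
    matEval_x2, matEval_x3, matEval_rowDiag, matEval_sqPos, ← pow_succ]

end Word

/-- The translation is purely syntactic, hence valid for every real square matrix; a final product
with the all-ones vector gives the row sums. -/
theorem exists_word_eval (l : ℕ) (hl : 2 ≤ l) (hl' : l ≤ 5) :
    ∃ w : Word .node .unit, ∀ (V : Type u) [Fintype V] [DecidableEq V] (A : Matrix V V ℝ),
      w.evalVec A = pathMatrix l A *ᵥ 1 := by
  suffices h : ∃ w : Word .node .node,
      ∀ (V : Type u) [Fintype V] [DecidableEq V] (A : Matrix V V ℝ),
        w.matEval A = pathMatrix l A by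
    obtain ⟨w, hw⟩ := h
    refine ⟨.mul w (.ones .var), fun V _ _ A => ?_⟩
    rw [← hw]; rfl
  interval_cases l
  · exact ⟨Word.x2, fun V _ _ A => Word.matEval_x2 A⟩
  · exact ⟨Word.x3, fun V _ _ A => Word.matEval_x3 A⟩
  · exact ⟨Word.x4, fun V _ _ A => Word.matEval_x4 A⟩
  · exact ⟨Word.x5, fun V _ _ A => Word.matEval_x5 A⟩

end PathCount

/-! ### Comparison of the path matrices with the closed forms -/

namespace PathCount

variable {V : Type u} [Fintype V] [DecidableEq V]

omit [Fintype V] in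
theorem offDiag_apply_ne {i j : V} (h : i ≠ j) : offDiag V i j = 1 := by simp [offDiag, h]

omit [Fintype V] in
theorem offDiag_apply_self (i : V) : offDiag V i i = 0 := by simp [offDiag]

omit [Fintype V] in
-- In diagonal form, products with these factors reduce entrywise to scalings of rows or columns.
theorem hadamard_one_eq_diagonal (M : Matrix V V ℝ) :
    M ⊙ (1 : Matrix V V ℝ) = Matrix.diagonal fun i => M i i := by
  ext i j
  by_cases h : i = j
  · subst h; simp
  · simp [h]

theorem X2_apply_self (A : Matrix V V ℝ) (i : V) : X2 A i i = 0 := by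
  simp [X2, offDiag_apply_self]

theorem X2_apply (A : Matrix V V ℝ) (i j : V) :
    X2 A i j = (A ^ 2) i j - if i = j then (A ^ 2) i i else 0 := by
  by_cases h : i = j
  · subst h; simp [X2_apply_self]
  · simp [X2, offDiag_apply_ne h, h]

theorem X3_apply (A : Matrix V V ℝ) {i j : V} (h : i ≠ j) :
    X3 A i j = (A ^ 3) i j - A i j * (A ^ 2) j j - (A ^ 2) i i * A i j + A i j := by
  simp only [X3, hadamard_one_eq_diagonal, Matrix.add_apply, Matrix.sub_apply,
    Matrix.hadamard_apply, offDiag_apply_ne h, Matrix.diagonal_mul, Matrix.mul_diagonal, mul_one]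

namespace IsAdj

variable {A : Matrix V V ℝ} (hA : IsAdj A)
include hA

theorem X2_eq_pathSum (i j : V) : X2 A i j = pathSum A 2 ∅ i j := by
  by_cases h : i = j
  · subst h; rw [pathSum_succ_self, X2_apply_self]
  · rw [hA.pathSum_two (by simp) (by simp) h]
    simp [X2_apply, h]

theorem X3_apply_self (i : V) : X3 A i i = 0 := by
  simp only [X3, hadamard_one_eq_diagonal, Matrix.add_apply, Matrix.sub_apply,
    Matrix.hadamard_apply, offDiag_apply_self, Matrix.diagonal_mul, Matrix.mul_diagonal, hA.diag]
  ring

theorem X3_eq_pathSum (i j : V) : X3 A i j = pathSum A 3 ∅ i j := by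
  by_cases h : i = j
  · subst h; rw [pathSum_succ_self, hA.X3_apply_self]
  · rw [hA.pathSum_three (by simp) (by simp) h]
    simp only [X3, hadamard_one_eq_diagonal, Matrix.add_apply, Matrix.sub_apply,
      Matrix.hadamard_apply, offDiag_apply_ne h, Matrix.diagonal_mul, Matrix.mul_diagonal,
      Finset.sum_empty, hA.symm i j]
    linear_combination (-1 - A i j) * hA.mul_self i j

theorem X4_eq_pathSum (i j : V) : X4 A i j = pathSum A 4 ∅ i j := by
  have hsub : (A ^ 2) ⊙ (1 : Matrix V V ℝ) - (2 : ℝ) • (1 : Matrix V V ℝ) =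
      Matrix.diagonal fun k => (A ^ 2) k k - 2 := by
    rw [hadamard_one_eq_diagonal]
    ext k m
    by_cases h : k = m
    · subst h; simp
    · simp [h]
  simp only [X4, hsub]
  by_cases h : i = j
  · subst h
    simp only [pathSum_succ_self, hadamard_one_eq_diagonal, Matrix.add_apply, Matrix.sub_apply,
      Matrix.hadamard_apply, offDiag_apply_self, Matrix.diagonal_mul, Matrix.mul_diagonal, hA.diag,
      X2_apply_self, Matrix.smul_apply, smul_eq_mul]
    ring
  · rw [hA.pathSum_four_empty h]
    simp only [hadamard_one_eq_diagonal, Matrix.add_apply, Matrix.sub_apply,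
      Matrix.hadamard_apply, offDiag_apply_ne h, Matrix.diagonal_mul, Matrix.mul_diagonal,
      X2_apply, h, if_false, Matrix.smul_apply, smul_eq_mul, Matrix.mul_apply (M := A * _)]
    have h' : ∀ k, A i k * ((A ^ 2) k k - 2) * A k j =
        A i k * (A ^ 2) k k * A k j - 2 * (A i k * A k j) := by intro k; ring
    simp only [h', Finset.sum_sub_distrib, ← Finset.mul_sum, sum_mul_apply]
    ring

/-- A 3-path from `i` to a neighbour closes up to a 4-cycle, so this counts the 4-cycles through `i`
with orientation. -/
theorem sum_mul_X3 (i : V) : ((A ⊙ X3 A) *ᵥ 1) i =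
    (A ^ 4) i i - ∑ k, A i k * (A ^ 2) k k - (A ^ 2) i i * (A ^ 2) i i + (A ^ 2) i i := by
  have h : ∀ k, (A ⊙ X3 A) i k * (1 : V → ℝ) k = A i k * (A ^ 3) k i - A i k * (A ^ 2) k k
      - A i k * (A ^ 2) i i + A i k := by
    intro k
    by_cases hk : i = k
    · subst hk; simp [hA.diag]
    · rw [Matrix.hadamard_apply, X3_apply A hk, hA.pow_symm 3 i k, Pi.one_apply]
      linear_combination (1 - (A ^ 2) k k - (A ^ 2) i i) * hA.mul_self i k
  simp only [Matrix.mulVec, dotProduct, h, Finset.sum_sub_distrib, Finset.sum_add_distrib,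
    ← Finset.sum_mul, sum_mul_pow_apply, hA.sum_row]

/-- Entries of `A ^ 2` are nonnegative, so the indicator is 0 only where the entry is. The last term
of `X5` thus contains `a * (a - 1)` for `a = (A ^ 2) i j`, the number of ordered pairs of distinct
common neighbours. -/
theorem mul_posInd (i j : V) : (A ^ 2) i j * posInd (A ^ 2) i j = (A ^ 2) i j := by
  rw [posInd, Matrix.of_apply]
  split_ifs with h
  · exact mul_one _
  · rw [le_antisymm (not_lt.1 h) (hA.sq_nonneg_apply i j), mul_zero]

theorem X5_eq_pathSum (i j : V) : X5 A i j = pathSum A 5 ∅ i j := by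
  have hsub : (A ^ 2) ⊙ (1 : Matrix V V ℝ) - (1 : Matrix V V ℝ) =
      Matrix.diagonal fun k => (A ^ 2) k k - 1 := by
    rw [hadamard_one_eq_diagonal, ← Matrix.diagonal_one, Matrix.diagonal_sub]
  simp only [X5, hsub]
  by_cases h : i = j
  · subst h
    simp only [pathSum_succ_self, hadamard_one_eq_diagonal, Matrix.add_apply, Matrix.sub_apply,
      Matrix.hadamard_apply, offDiag_apply_self, Matrix.diagonal_mul, Matrix.mul_diagonal, hA.diag,
      Matrix.diagonal_mul_diagonal, X2_apply_self, hA.X3_apply_self, Matrix.smul_apply, smul_eq_mul]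
    ring
  · rw [hA.pathSum_five_empty h]
    simp only [hadamard_one_eq_diagonal, Matrix.add_apply, Matrix.sub_apply,
      Matrix.hadamard_apply, offDiag_apply_ne h, Matrix.diagonal_mul, Matrix.mul_diagonal,
      X3_apply A h, Matrix.diagonal_mul_diagonal, Matrix.smul_apply, smul_eq_mul,
      hA.sum_mul_X3]
    -- In `h₁` and `h₂`, the zero diagonal of `X2 A` costs one correction term, at `k = j` and `k =
    -- i` respectively.
    have h₁ : (A * Matrix.diagonal (fun k => (A ^ 2) k k - 1) * X2 A) i j =
        ∑ k, A i k * (A ^ 2) k k * (A ^ 2) k j - (A ^ 3) i j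
          - A i j * ((A ^ 2) j j - 1) * (A ^ 2) j j := by
      have h' : ∀ k, A i k * ((A ^ 2) k k - 1) * X2 A k j = A i k * (A ^ 2) k k * (A ^ 2) k j
          - A i k * (A ^ 2) k j
          - if k = j then A i k * ((A ^ 2) k k - 1) * (A ^ 2) k k else 0 := by
        intro k
        rw [X2_apply]
        split_ifs <;> ring
      simp only [Matrix.mul_apply (N := X2 A), Matrix.mul_diagonal, h', Finset.sum_sub_distrib,
        sum_mul_pow_apply, Finset.sum_ite_eq', Finset.mem_univ, if_true]
    have h₂ : (X2 A * Matrix.diagonal (fun k => (A ^ 2) k k - 1) * A) i j =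
        ∑ k, (A ^ 2) i k * (A ^ 2) k k * A k j - (A ^ 3) i j
          - (A ^ 2) i i * ((A ^ 2) i i - 1) * A i j := by
      have h' : ∀ k, X2 A i k * ((A ^ 2) k k - 1) * A k j = (A ^ 2) i k * (A ^ 2) k k * A k j
          - (A ^ 2) i k * A k j
          - if i = k then (A ^ 2) i i * ((A ^ 2) k k - 1) * A k j else 0 := by
        intro k
        rw [X2_apply]
        split_ifs <;> ring
      have h₃ : ∑ k, (A ^ 2) i k * A k j = (A ^ 3) i j := by
        rw [← Matrix.mul_apply, ← pow_succ]
      simp only [Matrix.mul_apply (N := A), Matrix.mul_diagonal, h', Finset.sum_sub_distrib,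
        h₃, Finset.sum_ite_eq, Finset.mem_univ, if_true]
    have h₃ : (A * Matrix.diagonal (fun k => (A ^ 3) k k) * A) i j =
        ∑ k, A i k * (A ^ 3) k k * A k j := by
      simp only [Matrix.mul_apply (N := A), Matrix.mul_diagonal]
    have h₄ : (A * (A ⊙ (A ^ 2))) i j = ∑ k, A i k * (A ^ 2) k j * A k j := by
      rw [Matrix.mul_apply]
      exact Finset.sum_congr rfl fun k _ => by rw [Matrix.hadamard_apply]; ring
    have h₅ : ((A ⊙ (A ^ 2)) * A) i j = ∑ k, A i k * (A ^ 2) i k * A k j := Matrix.mul_apply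
    rw [h₁, h₂, h₃, h₄, h₅, X2_apply, if_neg h]
    -- The squares of `A i j` come from `3 • (A ⊙ X3 A)`; the second line removes the indicator.
    linear_combination 3 * (1 - (A ^ 2) i i - (A ^ 2) j j) * hA.mul_self i j
      - 3 * A i j * hA.mul_posInd i j

end IsAdj

theorem pathMatrix_eq_pathSum (G : SimpleGraph V) [DecidableRel G.Adj] {l : ℕ} (hl : 2 ≤ l)
    (hl' : l ≤ 5) (i j : V) :
    pathMatrix l (G.adjMatrix ℝ) i j = pathSum (G.adjMatrix ℝ) l ∅ i j := by
  have hA := isAdj_adjMatrix G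
  interval_cases l
  · exact hA.X2_eq_pathSum i j
  · exact hA.X3_eq_pathSum i j
  · exact hA.X4_eq_pathSum i j
  · exact hA.X5_eq_pathSum i j

end PathCount

theorem mainTheorem8 (l : ℕ) (hl : 2 ≤ l) (hl' : l ≤ 5) :
    ∃ w : PathCount.Word .node .unit,
      ∀ (V : Type u) [Fintype V] [DecidableEq V] (G : SimpleGraph V) [DecidableRel G.Adj],
        w.evalVec (G.adjMatrix ℝ) = PathCount.pathMatrix l (G.adjMatrix ℝ) *ᵥ 1 ∧
        ∀ i : V, (PathCount.pathMatrix l (G.adjMatrix ℝ) *ᵥ 1) i =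
          (PathCount.numPathsFrom G l i : ℝ) := by
  obtain ⟨w, hw⟩ := PathCount.exists_word_eval.{u} l hl hl'
  refine ⟨w, fun V _ _ G _ => ⟨hw V _, fun i => ?_⟩⟩
  rw [PathCount.numPathsFrom_eq_sum]
  simp only [Matrix.mulVec, dotProduct, Pi.one_apply, mul_one,
    PathCount.pathMatrix_eq_pathSum G hl hl']
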